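/- Let $\mathcal H$ be a complex Hilbert space, let $1<p<\infty$ and $q=p/(p-1)$, and write $\|T\|_r=[\mathrm{tr}(|T|^r)]^{1/r}$, $|T|=(T^*T)^{1/2}$, for the Schatten $r$-norm; $T$ is trace class if $\mathrm{tr}\,|T|<\infty$. Let $A_0$ be a normal trace-class operator on $\mathcal H$ with $\|A_0\|_1=1$. Then $A_0$ has a spectral decomposition $A_0=\sum_{n\in I}\mu_n(A_0)\,\langle u_n,\cdot\rangle u_n$, where $I=\{0,1,2,\dots\}$ is a finite or infinite initial segment of $\mathbb N$, $(u_n)_{n\in I}$ is orthonormal and $(\mu_n(A_0))_{n\in I}$ are the nonzero eigenvalues of $A_0$ repeated according to multiplicity (put $\mu_n(A_0)=0$ for $n\notin I$). For every such decomposition, $\sum_n|\mu_n(A_0)|<\infty$, so that for every $\varepsilon>0$ $$N_{A_0}(\varepsilon):=\min\Big\{N\in\mathbb N \;\Big|\; \sum_{n\ge N}|\mu_n(A_0)|<\varepsilon\Big\}$$ is well defined, and for every trace-class operator $A$ on $\mathcal H$ with $\|A\|_1=1$ both $\|A_0-A\|_1$ and $\|A_0-A\|_p$ are finite and $$\|A_0-A\|_1\le\Big(3\,N_{A_0}\big(\|A_0-A\|_p\big)^{1/q}+2\Big)\,\|A_0-A\|_p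 ,$$ where for $A=A_0$ the right-hand side is read as $0$. -/

import Mathlib

/-- The trace `∑ᵢ ⟨eᵢ, T eᵢ⟩ ∈ [0, ∞]` of a positive bounded operator `T` on a complex Hilbert space,
computed in some Hilbert basis `(eᵢ)`. By `posTrace_eq` the basis does not matter. -/
noncomputable def posTrace {H : Type*} [NormedAddCommGroup H] [InnerProductSpace ℂ H]
    [CompleteSpace H] (T : H →L[ℂ] H) : ENNReal :=
  ∑' i : (exists_hilbertBasis ℂ H).choose,
    ENNReal.ofReal (inner ℂ (i : H) (T (i : H))).re

/-- Parseval's identity with values in `[0, ∞]`. -/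
theorem hilbertBasis_tsum_ofReal_sq {H : Type*} [NormedAddCommGroup H] [InnerProductSpace ℂ H]
    {ι : Type*} (b : HilbertBasis ι ℂ H) (x : H) :
    ∑' i, ENNReal.ofReal (‖inner ℂ (b i) x‖ ^ 2) = ENNReal.ofReal (‖x‖ ^ 2) := by
  have h : HasSum (fun i => ‖inner ℂ (b i) x‖ ^ 2) (‖x‖ ^ 2) := by
    have h1 := Complex.hasSum_re (b.hasSum_inner_mul_inner x x)
    have h2 : (inner ℂ x x).re = ‖x‖ ^ 2 := by
      rw [inner_self_eq_norm_sq_to_K]; norm_cast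
    rw [h2] at h1
    have h3 : (fun i => (inner ℂ x (b i) * inner ℂ (b i) x).re)
        = fun i => ‖inner ℂ (b i) x‖ ^ 2 := by
      funext i
      rw [← inner_conj_symm x (b i), Complex.conj_mul']
      norm_cast
    rwa [h3] at h1
  rw [← ENNReal.ofReal_tsum_of_nonneg (fun _ => sq_nonneg _) h.summable, h.tsum_eq]

/-- The trace of a positive operator may be computed in any Hilbert basis. -/
theorem posTrace_eq {H : Type*} [NormedAddCommGroup H] [InnerProductSpace ℂ H]
    [CompleteSpace H] {T : H →L[ℂ] H} (hT : 0 ≤ T) {ι : Type*} (b : HilbertBasis ι ℂ H) :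
    posTrace T = ∑' i, ENNReal.ofReal (inner ℂ (b i) (T (b i))).re := by
  obtain ⟨c, hc⟩ := (exists_hilbertBasis ℂ H).choose_spec
  set S : H →L[ℂ] H := CFC.sqrt T with hS
  have hSS : S * S = T := CFC.sqrt_mul_sqrt_self T hT
  have hsa : ∀ x y : H, inner ℂ (S x) y = inner ℂ x (S y) := by
    have h0 : IsSelfAdjoint S := (CFC.sqrt_nonneg T).isSelfAdjoint
    exact fun x y => h0.isSymmetric x y
  have key : ∀ x : H, (inner ℂ x (T x)).re = ‖S x‖ ^ 2 := by
    intro x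
    rw [← hSS, mul_apply_eq_comp, ← hsa, inner_self_eq_norm_sq_to_K]
    norm_cast
  simp only [posTrace, key]
  calc ∑' i : (exists_hilbertBasis ℂ H).choose, ENNReal.ofReal (‖S (i : H)‖ ^ 2)
      = ∑' i, ∑' j, ENNReal.ofReal (‖inner ℂ (b j) (S (c i))‖ ^ 2) := by
        refine tsum_congr fun i => ?_
        rw [hilbertBasis_tsum_ofReal_sq, hc]
    _ = ∑' j, ∑' i, ENNReal.ofReal (‖inner ℂ (b j) (S (c i))‖ ^ 2) := ENNReal.tsum_comm
    _ = ∑' j, ∑' i, ENNReal.ofReal (‖inner ℂ (c i) (S (b j))‖ ^ 2) := by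
        refine tsum_congr fun j => tsum_congr fun i => ?_
        rw [← hsa, norm_inner_symm]
    _ = ∑' j, ENNReal.ofReal (‖S (b j)‖ ^ 2) :=
        tsum_congr fun j => hilbertBasis_tsum_ofReal_sq c _

/-- `tr (|A|ᵖ) ∈ [0, ∞]`, where `|A| = (A* A)^(1/2)` and the power is taken in the continuous
functional calculus. -/
noncomputable def traceAbsPow {H : Type*} [NormedAddCommGroup H] [InnerProductSpace ℂ H]
    [CompleteSpace H] (p : ℝ) (A : H →L[ℂ] H) : ENNReal :=
  posTrace (CFC.abs A ^ p)

/-- `A` belongs to the Schatten `p`-ideal: `tr (|A|ᵖ) < ∞`. For `p = 1`: `A` is trace class. -/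
def IsSchatten {H : Type*} [NormedAddCommGroup H] [InnerProductSpace ℂ H]
    [CompleteSpace H] (p : ℝ) (A : H →L[ℂ] H) : Prop :=
  traceAbsPow p A < ⊤

/-- The Schatten `p`-norm `(tr (|A|ᵖ))^(1/p)` of an operator in the Schatten `p`-ideal. -/
noncomputable def schattenNorm {H : Type*} [NormedAddCommGroup H] [InnerProductSpace ℂ H]
    [CompleteSpace H] (p : ℝ) (A : H →L[ℂ] H) : ℝ :=
  (traceAbsPow p A).toReal ^ (1 / p)

/-- `A = ∑_{n ∈ I} μₙ ⟨uₙ, ·⟩ uₙ` is a spectral decomposition of `A`: the index set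
`I = {n | μₙ ≠ 0}` is an initial segment `{0, 1, 2, …}` of `ℕ` (possibly empty or all of `ℕ`),
`(uₙ)_{n ∈ I}` is orthonormal, and the series converges to `A` in operator norm. Thus `(μₙ)_{n ∈ I}`
lists the nonzero eigenvalues of `A` with their multiplicities, and `μₙ = 0` for `n ∉ I`. -/
structure IsSpectralDecomposition {H : Type*} [NormedAddCommGroup H] [InnerProductSpace ℂ H]
    (A : H →L[ℂ] H) (μ : ℕ → ℂ) (u : ℕ → H) : Prop where
  initial : ∀ m n : ℕ, m ≤ n → μ n ≠ 0 → μ m ≠ 0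
  orthonormal : Orthonormal ℂ (fun n : {n : ℕ // μ n ≠ 0} => u n)
  hasSum : HasSum (fun n : ℕ => μ n • InnerProductSpace.rankOne ℂ (u n) (u n)) A

/-- The set of all `N ∈ ℕ` with `∑_{n ≥ N} |μₙ| < ε`. -/
def tailSet (μ : ℕ → ℂ) (ε : ℝ) : Set ℕ :=
  {N : ℕ | ∑' n : ℕ, ‖μ (N + n)‖ < ε}

/-- The least `N ∈ ℕ` with `∑_{n ≥ N} |μₙ| < ε` (used for summable `μ` and `ε > 0`). -/
noncomputable def tailIndex (μ : ℕ → ℂ) (ε : ℝ) : ℕ :=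
  sInf (tailSet μ ε)

/-! Write `D = A₀ - A`, `ε = ‖D‖_p`, let `N` be the tail index at `ε`, `P` the projection onto the
eigenvectors `uₙ` with `n < N` and `μₙ ≠ 0`, and `Q = 1 - P`. Split `D = PD + QDP + QA₀Q - QAQ`.
Since `P` has rank at most `N`, Hölder bounds each of `‖PD‖₁`, `‖QDP‖₁`, `‖PDP‖₁` by `N^(1/q) ε`,
and `‖QA₀Q‖₁` is at most the eigenvalue tail, hence at most `ε`. For the last term, pinching and
`‖A‖₁ = ‖A₀‖₁` give `‖QAQ‖₁ ≤ ‖A₀‖₁ - ‖PAP‖₁ ≤ ‖PA₀P‖₁ + ‖QA₀Q‖₁ - ‖PAP‖₁ ≤ ‖PDP‖₁ + ‖QA₀Q‖₁`. This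
adds up to three Hölder terms and two tails (`traceNorm_sub_le_of_proj`).

All facts about the trace norm come from one duality: `‖T‖₁` is the maximum of `∑ |⟨fᵢ, T eᵢ⟩|` over
pairs of Bessel families (`IsBessel.tsum_enorm_inner_le`, `exists_isBessel_tsum_eq`). Bessel rather
than orthonormal families are used because contractions preserve them, in particular the polar
factor `U` and its adjoint.

The decomposition exists because a trace-class operator is Hilbert–Schmidt, hence compact, and a
compact normal operator has an orthonormal eigenbasis. -/

/-- A family satisfying Bessel's inequality. -/
def IsBessel {H ι : Type*} [NormedAddCommGroup H] [InnerProductSpace ℂ H] (f : ι → H) : Prop :=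
  ∀ x : H, ∑' i, ‖inner ℂ (f i) x‖ₑ ^ 2 ≤ ‖x‖ₑ ^ 2

theorem ENNReal.two_mul_mul_le_add_sq (a b : ENNReal) : 2 * (a * b) ≤ a ^ 2 + b ^ 2 := by
  rcases eq_or_ne a ⊤ with rfl | ha
  · simp
  rcases eq_or_ne b ⊤ with rfl | hb
  · simp
  lift a to NNReal using ha
  lift b to NNReal using hb
  norm_cast
  rw [← NNReal.coe_le_coe]
  push_cast
  nlinarith [sq_nonneg ((a : ℝ) - b)]

theorem enorm_sq_eq_ofReal {E : Type*} [SeminormedAddCommGroup E] (x : E) :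
    ‖x‖ₑ ^ 2 = ENNReal.ofReal (‖x‖ ^ 2) := by
  rw [ENNReal.ofReal_pow (norm_nonneg _), ofReal_norm]

/-! ### Bessel families and the duality formula for the trace norm. -/

section

variable {H : Type*} [NormedAddCommGroup H] [InnerProductSpace ℂ H]

theorem Orthonormal.isBessel {ι : Type*} {v : ι → H} (hv : Orthonormal ℂ v) : IsBessel v := by
  intro x
  simp_rw [enorm_sq_eq_ofReal]
  rw [← ENNReal.ofReal_tsum_of_nonneg (fun _ => sq_nonneg _) (hv.inner_products_summable x)]
  exact ENNReal.ofReal_le_ofReal (hv.tsum_inner_products_le x)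

theorem IsBessel.sumElim {ι κ : Type*} {f : ι → H} {g : κ → H} {P Q : H → H}
    (hf : ∀ x, ∑' i, ‖inner ℂ (f i) x‖ₑ ^ 2 ≤ ‖P x‖ₑ ^ 2)
    (hg : ∀ x, ∑' i, ‖inner ℂ (g i) x‖ₑ ^ 2 ≤ ‖Q x‖ₑ ^ 2)
    (hPQ : ∀ x, ‖P x‖ ^ 2 + ‖Q x‖ ^ 2 ≤ ‖x‖ ^ 2) : IsBessel (Sum.elim f g) := by
  intro x
  rw [ENNReal.summable.tsum_sum ENNReal.summable]
  refine (add_le_add (hf x) (hg x)).trans ?_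
  simp_rw [enorm_sq_eq_ofReal]
  rw [← ENNReal.ofReal_add (by positivity) (by positivity)]
  exact ENNReal.ofReal_le_ofReal (hPQ x)

theorem IsBessel.norm_le_one {ι : Type*} {f : ι → H} (hf : IsBessel f) (i : ι) : ‖f i‖ ≤ 1 := by
  -- Testing Bessel's inequality on `f i` itself gives `‖f i‖⁴ ≤ ‖f i‖²`.
  have h := (ENNReal.le_tsum i).trans (hf (f i))
  rw [enorm_sq_eq_ofReal, enorm_sq_eq_ofReal, ENNReal.ofReal_le_ofReal_iff (by positivity),
    inner_self_eq_norm_sq_to_K] at h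
  simp only [Complex.coe_algebraMap, norm_pow, Complex.norm_real, norm_norm] at h
  by_contra! hc
  nlinarith [norm_nonneg (f i), mul_pos (sub_pos.2 hc) (sub_pos.2 hc), sq_nonneg (‖f i‖ ^ 2)]

theorem HilbertBasis.tsum_enorm_sq {ι : Type*} (b : HilbertBasis ι ℂ H) (x : H) :
    ∑' i, ‖inner ℂ (b i) x‖ₑ ^ 2 = ‖x‖ₑ ^ 2 := by
  simp_rw [enorm_sq_eq_ofReal]
  exact hilbertBasis_tsum_ofReal_sq b x

variable [CompleteSpace H]

theorem IsBessel.tsum_map_le {ι : Type*} {f : ι → H} (hf : IsBessel f) (B : H →L[ℂ] H) (x : H) :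
    ∑' i, ‖inner ℂ (B (f i)) x‖ₑ ^ 2 ≤ ‖star B x‖ₑ ^ 2 := by
  refine le_trans (le_of_eq ?_) (hf (star B x))
  simp only [ContinuousLinearMap.star_eq_adjoint, ContinuousLinearMap.adjoint_inner_right]

theorem IsBessel.map {ι : Type*} {f : ι → H} (hf : IsBessel f) {B : H →L[ℂ] H} (hB : ‖B‖ ≤ 1) :
    IsBessel fun i => B (f i) := by
  intro x
  refine (hf.tsum_map_le B x).trans ?_
  have : ‖star B x‖ ≤ ‖x‖ := by
    refine ((star B).le_opNorm x).trans ?_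
    rw [norm_star]
    exact mul_le_of_le_one_left (norm_nonneg _) hB
  simp_rw [enorm_sq_eq_ofReal]
  gcongr

theorem ofReal_inner_eq_enorm_sqrt_sq {T : H →L[ℂ] H} (hT : 0 ≤ T) (x : H) :
    ENNReal.ofReal (inner ℂ x (T x)).re = ‖CFC.sqrt T x‖ₑ ^ 2 := by
  have h0 : IsSelfAdjoint (CFC.sqrt T) := (CFC.sqrt_nonneg T).isSelfAdjoint
  have hs : inner ℂ (CFC.sqrt T x) (CFC.sqrt T x) = inner ℂ x (CFC.sqrt T (CFC.sqrt T x)) :=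
    h0.isSymmetric x (CFC.sqrt T x)
  rw [enorm_sq_eq_ofReal]
  congr 1
  nth_rewrite 1 [← CFC.sqrt_mul_sqrt_self T hT]
  rw [mul_apply_eq_comp, ← hs, inner_self_eq_norm_sq_to_K]
  norm_cast

/-- `∑ᵢ ‖S gᵢ‖² ≤ ∑ⱼ ‖S* bⱼ‖²` for a Bessel family `g`. -/
theorem IsBessel.tsum_enorm_apply_sq_le {ι κ : Type*} {g : ι → H} (hg : IsBessel g)
    (b : HilbertBasis κ ℂ H) (S : H →L[ℂ] H) :
    ∑' i, ‖S (g i)‖ₑ ^ 2 ≤ ∑' j, ‖star S (b j)‖ₑ ^ 2 := by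
  calc ∑' i, ‖S (g i)‖ₑ ^ 2
      = ∑' i, ∑' j, ‖inner ℂ (b j) (S (g i))‖ₑ ^ 2 := by simp_rw [b.tsum_enorm_sq]
    _ = ∑' j, ∑' i, ‖inner ℂ (b j) (S (g i))‖ₑ ^ 2 := ENNReal.tsum_comm
    _ = ∑' j, ∑' i, ‖inner ℂ (g i) (star S (b j))‖ₑ ^ 2 := by
        refine tsum_congr fun j => tsum_congr fun i => ?_
        rw [ContinuousLinearMap.star_eq_adjoint, ContinuousLinearMap.adjoint_inner_right,
          ← ofReal_norm, ← ofReal_norm, norm_inner_symm]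
    _ ≤ ∑' j, ‖star S (b j)‖ₑ ^ 2 := ENNReal.tsum_le_tsum fun j => hg _

theorem IsBessel.tsum_ofReal_inner_le_posTrace {ι : Type*} {g : ι → H} (hg : IsBessel g)
    {T : H →L[ℂ] H} (hT : 0 ≤ T) :
    ∑' i, ENNReal.ofReal (inner ℂ (g i) (T (g i))).re ≤ posTrace T := by
  obtain ⟨w, b, -⟩ := exists_hilbertBasis ℂ H
  have h0 : star (CFC.sqrt T) = CFC.sqrt T := (CFC.sqrt_nonneg T).isSelfAdjoint
  rw [posTrace_eq hT b]
  simp_rw [ofReal_inner_eq_enorm_sqrt_sq hT]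
  simpa only [h0] using hg.tsum_enorm_apply_sq_le b (CFC.sqrt T)

theorem norm_abs_apply (T : H →L[ℂ] H) (x : H) : ‖CFC.abs T x‖ = ‖T x‖ := by
  have h0 : IsSelfAdjoint (CFC.abs T) := (CFC.abs_nonneg T).isSelfAdjoint
  have h1 : inner ℂ (CFC.abs T x) (CFC.abs T x) = inner ℂ (T x) (T x) := by
    rw [show inner ℂ (CFC.abs T x) (CFC.abs T x) = inner ℂ x (CFC.abs T (CFC.abs T x)) from
      h0.isSymmetric x _, ← mul_apply_eq_comp, CFC.abs_mul_abs, mul_apply_eq_comp,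
      ContinuousLinearMap.star_eq_adjoint, ContinuousLinearMap.adjoint_inner_right]
  rw [inner_self_eq_norm_sq_to_K, inner_self_eq_norm_sq_to_K] at h1
  norm_cast at h1
  exact (sq_eq_sq₀ (norm_nonneg _) (norm_nonneg _)).1 h1

/-- Polar decomposition: a contraction `U` with `T = U |T|` and `|T| = U* T`. -/
theorem exists_polar (T : H →L[ℂ] H) :
    ∃ U : H →L[ℂ] H, ‖U‖ ≤ 1 ∧ U * CFC.abs T = T ∧ star U * T = CFC.abs T := by
  let K : Submodule ℂ H := (LinearMap.range ((CFC.abs T : H →L[ℂ] H) : H →ₗ[ℂ] H)).topologicalClosure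
  have hmem : ∀ x, CFC.abs T x ∈ K := fun x =>
    Submodule.le_topologicalClosure _ (LinearMap.mem_range_self ((CFC.abs T : H →L[ℂ] H) : H →ₗ[ℂ] H) x)
  have : CompleteSpace K := (Submodule.isClosed_topologicalClosure _).completeSpace_coe
  let e : H →ₗ[ℂ] K := LinearMap.codRestrict K ((CFC.abs T : H →L[ℂ] H) : H →ₗ[ℂ] H) hmem
  have he : DenseRange e := by
    intro y
    rw [Metric.mem_closure_iff]
    intro ε hε
    obtain ⟨_, ⟨x, rfl⟩, hx⟩ := Metric.mem_closure_iff.1 (show (y : H) ∈ closure _ from y.2) ε hε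
    exact ⟨_, ⟨x, rfl⟩, hx⟩
  have hn : ∀ x, ‖(T : H →ₗ[ℂ] H) x‖ ≤ 1 * ‖e x‖ := fun x => by
    rw [one_mul]; exact (norm_abs_apply T x).ge
  -- As `‖|T| x‖ = ‖T x‖`, the assignment `|T| x ↦ T x` is well defined and extends to the closure
  -- of the range; `U` is zero on the orthogonal complement.
  let V : K →L[ℂ] H := (T : H →ₗ[ℂ] H).extendOfNorm e
  let U : H →L[ℂ] H := V ∘L K.orthogonalProjectionOnto
  have hUle : ∀ x, ‖U x‖ ≤ ‖x‖ := fun x => by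
    have h1 : ‖V (K.orthogonalProjectionOnto x)‖ ≤ 1 * ‖K.orthogonalProjectionOnto x‖ :=
      LinearMap.norm_extendOfNorm_apply_le he 1 hn _
    rw [one_mul] at h1
    exact h1.trans (K.norm_orthogonalProjectionOnto_apply_le x)
  have hU : ‖U‖ ≤ 1 := U.opNorm_le_bound zero_le_one fun x => by rw [one_mul]; exact hUle x
  have hUT : ∀ x, U (CFC.abs T x) = T x := fun x => by
    have h1 : K.orthogonalProjectionOnto (CFC.abs T x) = e x :=
      K.orthogonalProjectionOnto_mem_subspace_eq_self (e x)
    have h2 : V (e x) = T x := LinearMap.extendOfNorm_eq he ⟨1, hn⟩ x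
    change V (K.orthogonalProjectionOnto (CFC.abs T x)) = T x
    rw [h1, h2]
  refine ⟨U, hU, ContinuousLinearMap.ext hUT, ContinuousLinearMap.ext fun x => ?_⟩
  -- Expanding the square, `‖U* T x - |T| x‖² ≤ ‖T x‖² - 2‖T x‖² + ‖T x‖² = 0`.
  rw [mul_apply_eq_comp, ← sub_eq_zero, ← norm_eq_zero, ← sq_eq_zero_iff]
  refine le_antisymm ?_ (sq_nonneg _)
  have h1 : ‖star U (T x)‖ ≤ ‖T x‖ := by
    refine ((star U).le_opNorm _).trans ?_
    rw [norm_star]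
    exact mul_le_of_le_one_left (norm_nonneg _) hU
  have h2 : (inner ℂ (star U (T x)) (CFC.abs T x)).re = ‖T x‖ ^ 2 := by
    rw [ContinuousLinearMap.star_eq_adjoint, ContinuousLinearMap.adjoint_inner_left, hUT,
      inner_self_eq_norm_sq_to_K]
    norm_cast
  have h3 := norm_sub_sq (𝕜 := ℂ) (star U (T x)) (CFC.abs T x)
  rw [norm_abs_apply] at h3
  change _ = _ - 2 * (inner ℂ (star U (T x)) (CFC.abs T x)).re + _ at h3
  rw [h3, h2]
  nlinarith [norm_nonneg (star U (T x)), norm_nonneg (T x)]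

theorem traceAbsPow_one (T : H →L[ℂ] H) : traceAbsPow 1 T = posTrace (CFC.abs T) := by
  rw [traceAbsPow, CFC.rpow_one _ (CFC.abs_nonneg T)]

/-- `|⟨y, T x⟩| ≤ (⟨x, |T| x⟩ + ⟨U* y, |T| U* y⟩) / 2` for a polar decomposition `T = U |T|`. -/
theorem two_mul_enorm_inner_le {T U : H →L[ℂ] H} (hU : U * CFC.abs T = T) (x y : H) :
    2 * ‖inner ℂ y (T x)‖ₑ ≤ ENNReal.ofReal (inner ℂ (star U y) (CFC.abs T (star U y))).re +
      ENNReal.ofReal (inner ℂ x (CFC.abs T x)).re := by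
  have hs : inner ℂ y (T x)
      = inner ℂ (CFC.sqrt (CFC.abs T) (star U y)) (CFC.sqrt (CFC.abs T) x) := by
    have h0 : IsSelfAdjoint (CFC.sqrt (CFC.abs T)) := (CFC.sqrt_nonneg _).isSelfAdjoint
    rw [show inner ℂ (CFC.sqrt (CFC.abs T) (star U y)) (CFC.sqrt (CFC.abs T) x) = _ from
      h0.isSymmetric _ _, ContinuousLinearMap.star_eq_adjoint,
      ContinuousLinearMap.adjoint_inner_left]
    nth_rewrite 1 [← hU, ← CFC.sqrt_mul_sqrt_self _ (CFC.abs_nonneg T)]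
    rfl
  rw [ofReal_inner_eq_enorm_sqrt_sq (CFC.abs_nonneg T),
    ofReal_inner_eq_enorm_sqrt_sq (CFC.abs_nonneg T), hs]
  refine le_trans ?_ (ENNReal.two_mul_mul_le_add_sq _ _)
  gcongr
  simp_rw [← ofReal_norm]
  rw [← ENNReal.ofReal_mul (norm_nonneg _)]
  exact ENNReal.ofReal_le_ofReal (norm_inner_le_norm _ _)

/-- Upper half of the duality: sum the symmetrized bound over `i`; both `e` and `U* f` are Bessel,
so each half contributes at most `tr |T|`. -/
theorem IsBessel.tsum_enorm_inner_le {ι : Type*} {e f : ι → H} (he : IsBessel e) (hf : IsBessel f)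
    (T : H →L[ℂ] H) : ∑' i, ‖inner ℂ (f i) (T (e i))‖ₑ ≤ traceAbsPow 1 T := by
  obtain ⟨U, hU1, hU, -⟩ := exists_polar T
  have hT := CFC.abs_nonneg T
  rw [traceAbsPow_one]
  have h := (ENNReal.tsum_le_tsum fun i => two_mul_enorm_inner_le hU (e i) (f i)).trans_eq
    ENNReal.tsum_add
  rw [ENNReal.tsum_mul_left] at h
  have h1 := (hf.map (B := star U) (by rwa [norm_star])).tsum_ofReal_inner_le_posTrace hT
  have h2 := h.trans (add_le_add h1 (he.tsum_ofReal_inner_le_posTrace hT))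
  rw [← two_mul] at h2
  exact (ENNReal.mul_le_mul_iff_right two_ne_zero ENNReal.ofNat_ne_top).1 h2

/-- The supremum is attained: for `fᵢ = U bᵢ` the coefficients become `⟨bᵢ, |T| bᵢ⟩`. -/
theorem exists_isBessel_tsum_eq {ι : Type*} (b : HilbertBasis ι ℂ H) (T : H →L[ℂ] H) :
    ∃ f : ι → H, IsBessel f ∧ ∑' i, ‖inner ℂ (f i) (T (b i))‖ₑ = traceAbsPow 1 T := by
  obtain ⟨U, hU1, -, hU⟩ := exists_polar T
  refine ⟨fun i => U (b i), b.orthonormal.isBessel.map hU1, ?_⟩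
  rw [traceAbsPow_one, posTrace_eq (CFC.abs_nonneg T) b]
  refine tsum_congr fun i => ?_
  have h1 : inner ℂ (U (b i)) (T (b i)) = inner ℂ (b i) (CFC.abs T (b i)) := by
    rw [← ContinuousLinearMap.adjoint_inner_right, ← hU]; rfl
  have h2 := ((ContinuousLinearMap.nonneg_iff_isPositive _).1 (CFC.abs_nonneg T)).inner_nonneg_right (b i)
  rw [h1, ← ofReal_norm, ← Complex.re_eq_norm.2 h2]

/-- The form in which duality proves inequalities. Index sets `w : Set H` suffice, since a Hilbert
basis is indexed by one. -/
theorem traceAbsPow_one_le {T : H →L[ℂ] H} {M : ENNReal}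
    (h : ∀ (w : Set H) (e f : w → H), IsBessel e → IsBessel f →
      ∑' i, ‖inner ℂ (f i) (T (e i))‖ₑ ≤ M) : traceAbsPow 1 T ≤ M := by
  obtain ⟨w, b, -⟩ := exists_hilbertBasis ℂ H
  obtain ⟨f, hf, hT⟩ := exists_isBessel_tsum_eq b T
  exact hT ▸ h w b f b.orthonormal.isBessel hf

theorem traceAbsPow_one_add_le (S T : H →L[ℂ] H) :
    traceAbsPow 1 (S + T) ≤ traceAbsPow 1 S + traceAbsPow 1 T := by
  refine traceAbsPow_one_le fun w e f he hf => ?_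
  refine le_trans ?_ (add_le_add (he.tsum_enorm_inner_le hf S) (he.tsum_enorm_inner_le hf T))
  rw [← ENNReal.tsum_add]
  refine ENNReal.tsum_le_tsum fun i => ?_
  rw [add_apply, inner_add_right]
  exact enorm_add_le _ _

theorem traceAbsPow_neg (p : ℝ) (T : H →L[ℂ] H) : traceAbsPow p (-T) = traceAbsPow p T := by
  rw [traceAbsPow, traceAbsPow, CFC.abs_neg]

theorem traceAbsPow_one_mul_mul_le {B C : H →L[ℂ] H} (hB : ‖B‖ ≤ 1) (hC : ‖C‖ ≤ 1)
    (T : H →L[ℂ] H) : traceAbsPow 1 (B * T * C) ≤ traceAbsPow 1 T := by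
  refine traceAbsPow_one_le fun w e f he hf => ?_
  refine le_trans (le_of_eq (tsum_congr fun i => ?_)) ((he.map hC).tsum_enorm_inner_le
    (hf.map (B := star B) (by rwa [norm_star])) T)
  rw [ContinuousLinearMap.star_eq_adjoint, ContinuousLinearMap.adjoint_inner_left]
  rfl

theorem traceAbsPow_one_star_le (T : H →L[ℂ] H) : traceAbsPow 1 (star T) ≤ traceAbsPow 1 T := by
  refine traceAbsPow_one_le fun w e f he hf => ?_
  refine le_trans (le_of_eq (tsum_congr fun i => ?_)) (hf.tsum_enorm_inner_le he T)
  rw [ContinuousLinearMap.star_eq_adjoint, ContinuousLinearMap.adjoint_inner_right,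
    ← ofReal_norm, ← ofReal_norm, norm_inner_symm]

/-- Pinching inequality for the trace norm. -/
theorem traceAbsPow_one_pinching {P Q : H →L[ℂ] H} (hP : star P = P) (hQ : star Q = Q)
    (hPQ : ∀ x, ‖P x‖ ^ 2 + ‖Q x‖ ^ 2 ≤ ‖x‖ ^ 2) (T : H →L[ℂ] H) :
    traceAbsPow 1 (P * T * P) + traceAbsPow 1 (Q * T * Q) ≤ traceAbsPow 1 T := by
  obtain ⟨w, b, -⟩ := exists_hilbertBasis ℂ H
  obtain ⟨f, hf, hPT⟩ := exists_isBessel_tsum_eq b (P * T * P)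
  obtain ⟨g, hg, hQT⟩ := exists_isBessel_tsum_eq b (Q * T * Q)
  have hb := b.orthonormal.isBessel
  have key : ∀ {u v : w → H}, IsBessel u → IsBessel v →
      IsBessel (Sum.elim (fun i => P (u i)) fun i => Q (v i)) := fun hu hv =>
    IsBessel.sumElim (P := P) (Q := Q) (fun x => by simpa only [hP] using hu.tsum_map_le P x)
      (fun x => by simpa only [hQ] using hv.tsum_map_le Q x) hPQ
  -- The joined families `(P b, Q b)` and `(P f, Q g)` are again Bessel, and testing `T` on them
  -- yields both traces at once.
  refine le_trans (le_of_eq ?_) ((key hb hb).tsum_enorm_inner_le (key hf hg) T)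
  rw [ENNReal.summable.tsum_sum ENNReal.summable, ← hPT, ← hQT]
  congr 1
  · refine tsum_congr fun i => ?_
    rw [Sum.elim_inl, Sum.elim_inl, ← ContinuousLinearMap.adjoint_inner_right,
      ← ContinuousLinearMap.star_eq_adjoint, hP]
    rfl
  · refine tsum_congr fun i => ?_
    rw [Sum.elim_inr, Sum.elim_inr, ← ContinuousLinearMap.adjoint_inner_right,
      ← ContinuousLinearMap.star_eq_adjoint, hQ]
    rfl

end

/-! ### Jensen and Hölder inequalities for Schatten norms. -/

section

variable {H : Type*} [NormedAddCommGroup H] [InnerProductSpace ℂ H]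

theorem re_inner_mono {S T : H →L[ℂ] H} (h : S ≤ T) (x : H) :
    (inner ℂ x (S x)).re ≤ (inner ℂ x (T x)).re := by
  have h1 := ((ContinuousLinearMap.le_def _ _).1 h).re_inner_nonneg_right x
  rw [sub_apply, inner_sub_right, map_sub] at h1
  exact sub_nonneg.1 h1

theorem re_inner_real_smul (c : ℝ) (S : H →L[ℂ] H) (x : H) :
    (inner ℂ x ((c • S) x)).re = c * (inner ℂ x (S x)).re := by
  rw [smul_apply, ← Complex.coe_smul, inner_smul_right, Complex.re_ofReal_mul]

theorem isBessel_unit {x : H} (hx : ‖x‖ ≤ 1) : IsBessel fun _ : Unit => x := by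
  intro y
  rw [tsum_fintype, Finset.univ_unique, Finset.sum_singleton, enorm_sq_eq_ofReal,
    enorm_sq_eq_ofReal]
  refine ENNReal.ofReal_le_ofReal (pow_le_pow_left₀ (norm_nonneg _) ?_ 2)
  exact (norm_inner_le_norm x y).trans (mul_le_of_le_one_left (norm_nonneg _) hx)

theorem re_inner_nonneg {S : H →L[ℂ] H} (h : 0 ≤ S) (x : H) : 0 ≤ (inner ℂ x (S x)).re := by
  simpa using re_inner_mono h x

/-- The orthogonal projection onto the span of a finite orthonormal family `v`. -/
noncomputable def spanProj {ι : Type*} [Fintype ι] (v : ι → H) : H →L[ℂ] H :=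
  ∑ i, InnerProductSpace.rankOne ℂ (v i) (v i)

theorem spanProj_apply {ι : Type*} [Fintype ι] (v : ι → H) (x : H) :
    spanProj v x = ∑ i, inner ℂ (v i) x • v i := by
  simp [spanProj, sum_apply]

theorem spanProj_apply_self {ι : Type*} [Fintype ι] {v : ι → H} (hv : Orthonormal ℂ v) (i : ι) :
    spanProj v (v i) = v i := by
  classical
  rw [spanProj_apply]
  simp [orthonormal_iff_ite.1 hv]

theorem spanProj_mul_self {ι : Type*} [Fintype ι] {v : ι → H} (hv : Orthonormal ℂ v) :
    spanProj v * spanProj v = spanProj v := by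
  ext x
  rw [mul_apply_eq_comp]
  nth_rewrite 2 [spanProj_apply]
  simp only [map_sum, map_smul, spanProj_apply_self hv]
  rw [spanProj_apply]

variable [CompleteSpace H]

/-- Jensen's inequality `⟨g, S g⟩ᵖ ≤ ⟨g, Sᵖ g⟩` for `S ≥ 0` and `‖g‖ ≤ 1`. -/
theorem rpow_re_inner_le {p q : ℝ} (hpq : p.HolderConjugate q) {S : H →L[ℂ] H} (hS : 0 ≤ S)
    {g : H} (hg : ‖g‖ ≤ 1) : (inner ℂ g (S g)).re ^ p ≤ (inner ℂ g ((S ^ p) g)).re := by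
  set t := (inner ℂ g (S g)).re with ht
  have ht0 : 0 ≤ t := re_inner_nonneg hS g
  have hp0 : 0 < p := hpq.pos
  have hsa : IsSelfAdjoint S := hS.isSelfAdjoint
  have hspec : ∀ x ∈ spectrum ℝ S, 0 ≤ x := fun x hx => spectrum_nonneg_of_nonneg hS hx
  -- The tangent line to `x ↦ x ^ p` at `t` lies below the graph on `[0, ∞)` (Young's inequality);
  -- the functional calculus carries this over to `S`.
  have hle : (p * t ^ (p - 1)) • S - algebraMap ℝ (H →L[ℂ] H) ((p - 1) * t ^ p) ≤ S ^ p := by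
    have h1 : cfc (fun x : ℝ => p * t ^ (p - 1) * x - (p - 1) * t ^ p) S
        = (p * t ^ (p - 1)) • S - algebraMap ℝ (H →L[ℂ] H) ((p - 1) * t ^ p) := by
      rw [cfc_sub (fun x : ℝ => p * t ^ (p - 1) * x) (fun _ => (p - 1) * t ^ p) S,
        cfc_const_mul_id _ S, cfc_const _ S]
    rw [← h1, CFC.rpow_eq_cfc_real hS]
    refine cfc_mono (fun x hx => ?_) (by fun_prop)
      (continuousOn_id.rpow_const fun _ _ => Or.inr hp0.le)
    have hy := Real.young_inequality_of_nonneg (hspec x hx) (Real.rpow_nonneg ht0 (p - 1)) hpq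
    rw [← Real.rpow_mul ht0, hpq.sub_one_mul_conj, div_eq_mul_inv (t ^ p), ← hpq.one_sub_inv] at hy
    have h2 := mul_le_mul_of_nonneg_left hy hp0.le
    have h3 : p * (x ^ p / p + t ^ p * (1 - p⁻¹)) = x ^ p + (p - 1) * t ^ p := by
      field_simp
    rw [h3] at h2
    linarith
  have h := re_inner_mono hle g
  rw [sub_apply, inner_sub_right, Complex.sub_re, re_inner_real_smul, ← ht,
    Algebra.algebraMap_eq_smul_one, re_inner_real_smul, one_apply_eq_self] at h
  have h4 : (inner ℂ g g).re = ‖g‖ ^ 2 := by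
    rw [inner_self_eq_norm_sq_to_K]; norm_cast
  have h5 : t ^ (p - 1) * t = t ^ p := by
    rcases ht0.eq_or_lt with h0 | h0
    · rw [← h0, mul_zero, Real.zero_rpow hp0.ne']
    · rw [← Real.rpow_add_one h0.ne']; congr 1; ring
  have h6 : (p - 1) * t ^ p * ‖g‖ ^ 2 ≤ (p - 1) * t ^ p :=
    mul_le_of_le_one_right (mul_nonneg hpq.sub_one_pos.le (Real.rpow_nonneg ht0 p))
      (pow_le_one₀ (norm_nonneg _) hg)
  rw [h4, mul_assoc, h5] at h
  linarith

theorem Real.sum_le_card_rpow_mul {ι : Type*} [Fintype ι] {a : ι → ℝ} {p q τ : ℝ}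
    (hpq : p.HolderConjugate q) (ha : ∀ i, 0 ≤ a i) (h : ∑ i, a i ^ p ≤ τ) :
    ∑ i, a i ≤ (Fintype.card ι : ℝ) ^ (1 / q) * τ ^ (1 / p) := by
  have h1 := Real.inner_le_Lp_mul_Lq Finset.univ a (fun _ => 1) hpq
  simp only [mul_one, abs_one, Real.one_rpow, Finset.sum_const, Finset.card_univ, nsmul_eq_mul,
    abs_of_nonneg (ha _)] at h1
  rw [mul_comm] at h1
  exact h1.trans (mul_le_mul_of_nonneg_left (Real.rpow_le_rpow
    (Finset.sum_nonneg fun i _ => Real.rpow_nonneg (ha i) _) h (one_div_nonneg.2 hpq.nonneg))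
    (Real.rpow_nonneg (Nat.cast_nonneg _) _))

theorem IsBessel.sum_re_inner_le {ι : Type*} [Fintype ι] {g : ι → H} (hg : IsBessel g)
    {T : H →L[ℂ] H} (hT : 0 ≤ T) (h : posTrace T ≠ ⊤) :
    ∑ i, (inner ℂ (g i) (T (g i))).re ≤ (posTrace T).toReal := by
  rw [← ENNReal.ofReal_le_iff_le_toReal h,
    ENNReal.ofReal_sum_of_nonneg fun i _ => re_inner_nonneg hT _, ← tsum_fintype (L := .unconditional ι)]
  exact hg.tsum_ofReal_inner_le_posTrace hT

/-- Jensen bounds the sum of the `p`-th powers of the terms by `tr |T|ᵖ`; Hölder against the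
constant `1` then produces the cardinality factor. -/
theorem IsBessel.sum_re_inner_abs_le {ι : Type*} [Fintype ι] {g : ι → H} (hg : IsBessel g)
    {p q : ℝ} (hpq : p.HolderConjugate q) {T : H →L[ℂ] H} (hT : IsSchatten p T) :
    ∑ i, (inner ℂ (g i) (CFC.abs T (g i))).re ≤
      (Fintype.card ι : ℝ) ^ (1 / q) * schattenNorm p T := by
  have hS := CFC.abs_nonneg T
  unfold schattenNorm
  unfold IsSchatten at hT
  unfold traceAbsPow at hT ⊢
  generalize CFC.abs T = S at hS hT ⊢
  exact Real.sum_le_card_rpow_mul hpq (fun i => re_inner_nonneg hS _)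
    ((Finset.sum_le_sum fun i _ => rpow_re_inner_le hpq hS (hg.norm_le_one i)).trans
      (hg.sum_re_inner_le CFC.rpow_nonneg hT.ne))

/-- Hölder's inequality for finite Bessel families. -/
theorem IsBessel.sum_norm_inner_le {ι : Type*} [Fintype ι] {e f : ι → H} (he : IsBessel e)
    (hf : IsBessel f) {p q : ℝ} (hpq : p.HolderConjugate q) {T : H →L[ℂ] H}
    (hT : IsSchatten p T) :
    ∑ i, ‖inner ℂ (f i) (T (e i))‖ ≤ (Fintype.card ι : ℝ) ^ (1 / q) * schattenNorm p T := by
  obtain ⟨U, hU1, hU, -⟩ := exists_polar T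
  have hS := CFC.abs_nonneg T
  have h1 : ∀ i, 2 * ‖inner ℂ (f i) (T (e i))‖ ≤
      (inner ℂ (star U (f i)) (CFC.abs T (star U (f i)))).re +
        (inner ℂ (e i) (CFC.abs T (e i))).re := by
    intro i
    have h := two_mul_enorm_inner_le hU (e i) (f i)
    rw [← ENNReal.ofReal_add (re_inner_nonneg hS _) (re_inner_nonneg hS _), ← ofReal_norm,
      ← ENNReal.ofReal_ofNat 2, ← ENNReal.ofReal_mul (by norm_num)] at h
    exact (ENNReal.ofReal_le_ofReal_iff
      (add_nonneg (re_inner_nonneg hS _) (re_inner_nonneg hS _))).1 h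
  have h2 := Finset.sum_le_sum fun i (_ : i ∈ Finset.univ) => h1 i
  rw [← Finset.mul_sum, Finset.sum_add_distrib] at h2
  have h3 := (hf.map (B := star U) (by rwa [norm_star])).sum_re_inner_abs_le hpq hT
  have h4 := he.sum_re_inner_abs_le hpq hT
  linarith

/-- Hölder for one-element families bounds every single coefficient `⟨fᵢ, T eᵢ⟩` by the `p`-norm.
This settles the case `A = A₀`. -/
theorem traceAbsPow_one_eq_zero {p q : ℝ} (hpq : p.HolderConjugate q) {T : H →L[ℂ] H}
    (hT : IsSchatten p T) (h : schattenNorm p T = 0) : traceAbsPow 1 T = 0 := by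
  refine le_antisymm (traceAbsPow_one_le fun w e f he hf => ?_) (by simp)
  refine (ENNReal.tsum_eq_zero.2 fun i => ?_).le
  have h1 := (isBessel_unit (he.norm_le_one i)).sum_norm_inner_le
    (isBessel_unit (hf.norm_le_one i)) hpq hT
  rw [h, mul_zero, Finset.univ_unique, Finset.sum_singleton] at h1
  rw [enorm_eq_zero, ← norm_eq_zero]
  exact le_antisymm h1 (norm_nonneg _)

/-- Trace class operators belong to all Schatten ideals. -/
theorem IsSchatten.of_one {p : ℝ} (hp : 1 < p) {T : H →L[ℂ] H} (hT : IsSchatten 1 T) :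
    IsSchatten p T := by
  have hS := CFC.abs_nonneg T
  have hsa : IsSelfAdjoint (CFC.abs T) := hS.isSelfAdjoint
  -- On the spectrum `x ^ p ≤ c * x`. The factor `‖1‖` covers the trivial space, where it is not
  -- `1`.
  set c : ℝ := (‖CFC.abs T‖ * ‖(1 : H →L[ℂ] H)‖) ^ (p - 1) with hc
  have hc0 : 0 ≤ c := Real.rpow_nonneg (by positivity) _
  have hle : CFC.abs T ^ p ≤ c • CFC.abs T := by
    rw [CFC.rpow_eq_cfc_real hS, ← cfc_const_mul_id c (CFC.abs T)]
    refine cfc_mono (fun x hx => ?_)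
      (continuousOn_id.rpow_const fun _ _ => Or.inr (zero_le_one.trans hp.le)) (by fun_prop)
    have hx0 : 0 ≤ x := spectrum_nonneg_of_nonneg hS hx
    have hx1 := spectrum.norm_le_norm_mul_of_mem hx
    rw [Real.norm_of_nonneg hx0] at hx1
    rcases hx0.eq_or_lt with rfl | h0
    · rw [Real.zero_rpow (by linarith), mul_zero]
    · rw [show x ^ p = x ^ (p - 1) * x by rw [← Real.rpow_add_one h0.ne', sub_add_cancel]]
      exact mul_le_mul_of_nonneg_right (Real.rpow_le_rpow hx0 hx1 (by linarith)) hx0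
  have h1 : traceAbsPow p T ≤ ENNReal.ofReal c * traceAbsPow 1 T := by
    rw [traceAbsPow_one, traceAbsPow, posTrace, posTrace, ← ENNReal.tsum_mul_left]
    refine ENNReal.tsum_le_tsum fun i => ?_
    rw [← ENNReal.ofReal_mul hc0, ← re_inner_real_smul]
    exact ENNReal.ofReal_le_ofReal (re_inner_mono hle _)
  exact h1.trans_lt (ENNReal.mul_lt_top ENNReal.ofReal_lt_top hT)

theorem tsum_enorm_apply_sq_eq_traceAbsPow_two {ι : Type*} (b : HilbertBasis ι ℂ H)
    (T : H →L[ℂ] H) : ∑' i, ‖T (b i)‖ₑ ^ 2 = traceAbsPow 2 T := by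
  rw [traceAbsPow, posTrace_eq CFC.rpow_nonneg b]
  refine tsum_congr fun i => ?_
  have h : CFC.abs T ^ (2 : ℝ) = star T * T := by
    have := CFC.rpow_natCast (CFC.abs T) 2 (CFC.abs_nonneg T)
    rw [Nat.cast_ofNat] at this
    rw [this, pow_two, CFC.abs_mul_abs]
  rw [h, mul_apply_eq_comp, ContinuousLinearMap.star_eq_adjoint,
    ContinuousLinearMap.adjoint_inner_right, inner_self_eq_norm_sq_to_K, enorm_sq_eq_ofReal]
  norm_cast

/-! ### Finite-rank projections and the rank-dependent trace-norm bound. -/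

section projection

variable {ι : Type*} [Fintype ι] {v : ι → H}

theorem star_spanProj (v : ι → H) : star (spanProj v) = spanProj v := by
  rw [ContinuousLinearMap.star_eq_adjoint, eq_comm, ContinuousLinearMap.eq_adjoint_iff]
  intro x y
  simp only [spanProj_apply, sum_inner, inner_sum, inner_smul_left, inner_smul_right,
    inner_conj_symm]
  exact Finset.sum_congr rfl fun i _ => mul_comm _ _

theorem spanProj_norm_sq_add (hv : Orthonormal ℂ v) (x : H) :
    ‖spanProj v x‖ ^ 2 + ‖(1 - spanProj v) x‖ ^ 2 = ‖x‖ ^ 2 := by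
  have h : inner ℂ (spanProj v x) ((1 - spanProj v) x) = 0 := by
    rw [← star_spanProj, ContinuousLinearMap.star_eq_adjoint,
      ContinuousLinearMap.adjoint_inner_left, ← ContinuousLinearMap.star_eq_adjoint,
      star_spanProj, ← mul_apply_eq_comp, mul_sub, mul_one, spanProj_mul_self hv, sub_self,
      zero_apply, inner_zero_right]
  have h1 := norm_add_sq_eq_norm_sq_add_norm_sq_of_inner_eq_zero _ _ h
  rw [sub_apply, one_apply_eq_self, add_sub_cancel] at h1
  rw [sub_apply, one_apply_eq_self]
  nlinarith

theorem norm_spanProj_le (hv : Orthonormal ℂ v) : ‖spanProj v‖ ≤ 1 :=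
  ContinuousLinearMap.opNorm_le_bound _ zero_le_one fun x => by
    rw [one_mul]
    have := spanProj_norm_sq_add hv x
    exact (le_abs_self _).trans (abs_le_of_sq_le_sq (by nlinarith [sq_nonneg ‖(1 - spanProj v) x‖]) (norm_nonneg _))

theorem norm_one_sub_spanProj_le (hv : Orthonormal ℂ v) : ‖1 - spanProj v‖ ≤ 1 :=
  ContinuousLinearMap.opNorm_le_bound _ zero_le_one fun x => by
    rw [one_mul]
    have := spanProj_norm_sq_add hv x
    exact (le_abs_self _).trans (abs_le_of_sq_le_sq (by nlinarith [sq_nonneg ‖spanProj v x‖]) (norm_nonneg _))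

/-- Extend `v` to a Hilbert basis: `T * spanProj v` kills the added vectors, so only the indices in
`ι` survive in the duality formula. -/
theorem exists_isBessel_traceAbsPow_mul_spanProj (hv : Orthonormal ℂ v) (T : H →L[ℂ] H) :
    ∃ f : ι → H, IsBessel f ∧
      traceAbsPow 1 (T * spanProj v) = ∑ i, ‖inner ℂ (f i) (T (v i))‖ₑ := by
  obtain ⟨w, b, hw, hb⟩ := hv.toSubtypeRange.exists_hilbertBasis_extension
  obtain ⟨f, hf, hfT⟩ := exists_isBessel_tsum_eq b (T * spanProj v)
  let φ : ι → w := fun i => ⟨v i, hw ⟨i, rfl⟩⟩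
  have hφ : Function.Injective φ := fun i j h =>
    hv.linearIndependent.injective (congrArg Subtype.val h)
  have hbφ : ∀ i, b (φ i) = v i := fun i => by rw [hb]
  refine ⟨f ∘ φ, fun x => ?_, ?_⟩
  · exact (ENNReal.tsum_comp_le_tsum_of_injective hφ fun i => ‖inner ℂ (f i) x‖ₑ ^ 2).trans (hf x)
  · rw [← hfT, ← tsum_fintype (L := .unconditional ι), ← hφ.tsum_eq]
    · refine tsum_congr fun i => ?_
      rw [mul_apply_eq_comp, hbφ, spanProj_apply_self hv]; rfl
    · intro j hj
      by_contra hc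
      refine hj ?_
      have : spanProj v (b j) = 0 := by
        rw [spanProj_apply]
        refine Finset.sum_eq_zero fun i _ => ?_
        rw [← hbφ, b.orthonormal.2, zero_smul]
        exact fun h => hc ⟨i, h⟩
      beta_reduce
      rw [mul_apply_eq_comp, this, map_zero, inner_zero_right, enorm_zero]

theorem sum_enorm_le_ofReal {z : ι → ℂ} {M : ℝ} (h : ∑ i, ‖z i‖ ≤ M) :
    ∑ i, ‖z i‖ₑ ≤ ENNReal.ofReal M := by
  simp_rw [← ofReal_norm]
  rw [← ENNReal.ofReal_sum_of_nonneg fun _ _ => norm_nonneg _]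
  exact ENNReal.ofReal_le_ofReal h

theorem traceAbsPow_mul_spanProj_le (hv : Orthonormal ℂ v) {p q : ℝ} (hpq : p.HolderConjugate q)
    {T : H →L[ℂ] H} (hT : IsSchatten p T) : traceAbsPow 1 (T * spanProj v) ≤
      ENNReal.ofReal ((Fintype.card ι : ℝ) ^ (1 / q) * schattenNorm p T) := by
  obtain ⟨f, hf, h⟩ := exists_isBessel_traceAbsPow_mul_spanProj hv T
  rw [h]
  exact sum_enorm_le_ofReal (hv.isBessel.sum_norm_inner_le hf hpq hT)

theorem traceAbsPow_spanProj_mul_le (hv : Orthonormal ℂ v) {p q : ℝ} (hpq : p.HolderConjugate q)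
    {T : H →L[ℂ] H} (hT : IsSchatten p T) : traceAbsPow 1 (spanProj v * T) ≤
      ENNReal.ofReal ((Fintype.card ι : ℝ) ^ (1 / q) * schattenNorm p T) := by
  have h1 : spanProj v * T = star (star T * spanProj v) := by
    rw [star_mul, star_star, star_spanProj]
  obtain ⟨f, hf, h⟩ := exists_isBessel_traceAbsPow_mul_spanProj hv (star T)
  rw [h1]
  refine (traceAbsPow_one_star_le _).trans ?_
  rw [h]
  -- Passing to the adjoint swaps the two Bessel families, so Hölder is applied to `T` itself and
  -- the `p`-norm of `star T` never enters.
  refine sum_enorm_le_ofReal (le_trans (le_of_eq (Finset.sum_congr rfl fun i _ => ?_))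
    (hf.sum_norm_inner_le hv.isBessel hpq hT))
  rw [ContinuousLinearMap.star_eq_adjoint, ContinuousLinearMap.adjoint_inner_right,
    norm_inner_symm]

end projection

end

/-! ### Spectral theorem for compact normal operators; trace class implies compact. -/

section

variable {H : Type*} [NormedAddCommGroup H] [InnerProductSpace ℂ H]

/-- `T - c` is normal, so it has the same kernel as its adjoint. -/
theorem IsStarNormal.adjoint_apply_of_apply_eq_smul [CompleteSpace H] {T : H →L[ℂ] H}
    (hT : IsStarNormal T) {x : H} {c : ℂ} (hx : T x = c • x) :
    ContinuousLinearMap.adjoint T x = (starRingEnd ℂ) c • x := by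
  have h1 : IsStarNormal (T - algebraMap ℂ (H →L[ℂ] H) c) := by
    have hc : Commute (star T) (algebraMap ℂ (H →L[ℂ] H) c) := (Algebra.commutes c _).symm
    have hc' : Commute (algebraMap ℂ (H →L[ℂ] H) (star c)) T := Algebra.commutes _ _
    have hc'' : Commute (algebraMap ℂ (H →L[ℂ] H) (star c)) (algebraMap ℂ (H →L[ℂ] H) c) :=
      Algebra.commutes _ _
    refine ⟨?_⟩
    rw [star_sub, ← algebraMap_star_comm]
    exact (hT.star_comm_self.sub_right hc).sub_left (hc'.sub_right hc'')
  have h2 := (ContinuousLinearMap.IsStarNormal.adjoint_apply_eq_zero_iff h1 x).2 (by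
    rw [sub_apply, Algebra.algebraMap_eq_smul_one, smul_apply, one_apply_eq_self, hx, sub_self])
  rw [← ContinuousLinearMap.star_eq_adjoint, star_sub, ← algebraMap_star_comm, sub_apply,
    Algebra.algebraMap_eq_smul_one, smul_apply, one_apply_eq_self, sub_eq_zero] at h2
  exact h2

/-- A compact normal operator on a nontrivial complex Hilbert space has an eigenvector. -/
theorem IsStarNormal.exists_eigenvector [CompleteSpace H] [Nontrivial H] {T : H →L[ℂ] H}
    (hT : IsStarNormal T) (hc : IsCompactOperator T) : ∃ (x : H) (c : ℂ), x ≠ 0 ∧ T x = c • x := by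
  rcases eq_or_ne T 0 with rfl | h0
  · obtain ⟨x, hx⟩ := exists_ne (0 : H)
    exact ⟨x, 0, hx, by simp⟩
  -- For normal `T ≠ 0` the spectral radius `‖T‖` is attained at a nonzero spectral value, which
  -- compactness makes an eigenvalue.
  obtain ⟨z, hz, hzn⟩ := spectrum.exists_nnnorm_eq_spectralRadius T
  rw [IsStarNormal.spectralRadius_eq_nnnorm T, ENNReal.coe_inj] at hzn
  have hz0 : z ≠ 0 := by
    rintro rfl
    rw [nnnorm_zero, eq_comm, nnnorm_eq_zero] at hzn
    exact h0 hzn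
  obtain ⟨x, hx⟩ := ((hc.hasEigenvalue_iff_mem_spectrum hz0).2 hz).exists_hasEigenvector
  exact ⟨x, z, hx.2, hx.apply_eq_smul⟩

theorem orthonormal_insert {w : Set H} (hw : Orthonormal ℂ ((↑) : w → H)) {x : H} (hx : ‖x‖ = 1)
    (hxw : ∀ e ∈ w, inner ℂ e x = 0) : Orthonormal ℂ (Subtype.val : ↥(insert x w : Set H) → H) := by
  refine ⟨?_, ?_⟩
  · rintro ⟨y, rfl | hy⟩
    · exact hx
    · exact hw.1 ⟨y, hy⟩
  · rintro ⟨y, hy⟩ ⟨z, hz⟩ hyz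
    have hne : y ≠ z := fun h => hyz (Subtype.ext h)
    change inner ℂ y z = 0
    rcases hy with rfl | hy <;> rcases hz with rfl | hz
    · exact (hne rfl).elim
    · exact inner_eq_zero_symm.1 (hxw z hz)
    · exact hxw y hy
    · exact hw.2 (i := ⟨y, hy⟩) (j := ⟨z, hz⟩) fun h => hne (congrArg Subtype.val h)

theorem mem_orthogonal_span_iff {w : Set H} {x : H} :
    x ∈ (Submodule.span ℂ w)ᗮ ↔ ∀ e ∈ w, inner ℂ e x = 0 := by
  rw [Submodule.mem_orthogonal]
  refine ⟨fun h e he => h e (Submodule.subset_span he), fun h u hu => ?_⟩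
  induction hu using Submodule.span_induction with
  | mem e he => exact h e he
  | zero => exact inner_zero_left _
  | add a b _ _ ha hb => rw [inner_add_left, ha, hb, add_zero]
  | smul c a _ ha => rw [inner_smul_left, ha, mul_zero]

/-- The spectral theorem for compact normal operators. -/
theorem IsStarNormal.exists_hilbertBasis_eigenvectors [CompleteSpace H] {T : H →L[ℂ] H}
    (hT : IsStarNormal T) (hc : IsCompactOperator T) :
    ∃ (w : Set H) (b : HilbertBasis w ℂ H) (c : w → ℂ), ∀ i, T (b i) = c i • b i := by
  -- Take a maximal orthonormal set of eigenvectors. Its orthogonal complement is invariant under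
  -- `T` and `T*`; an eigenvector there would contradict maximality.
  obtain ⟨w, -, hw⟩ := zorn_subset_nonempty
    {s : Set H | Orthonormal ℂ ((↑) : s → H) ∧ ∀ e ∈ s, ∃ c : ℂ, T e = c • e}
    (fun c hc cc _ => ⟨⋃₀ c, ⟨orthonormal_sUnion_of_directed cc.directedOn fun x xc => (hc xc).1,
      fun e ⟨s, hs, he⟩ => (hc hs).2 e he⟩, fun _ => Set.subset_sUnion_of_mem⟩) ∅
    ⟨orthonormal_empty ℂ H, fun e he => he.elim⟩
  obtain ⟨how, hew⟩ := hw.prop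
  set M := (Submodule.span ℂ w)ᗮ with hM
  have hTM : ∀ x ∈ M, T x ∈ M := fun x hx => by
    rw [hM, mem_orthogonal_span_iff] at hx ⊢
    intro e he
    obtain ⟨c, hce⟩ := hew e he
    rw [← ContinuousLinearMap.adjoint_inner_left, hT.adjoint_apply_of_apply_eq_smul hce,
      inner_smul_left, hx e he, mul_zero]
  have hTM' : ∀ x ∈ M, ContinuousLinearMap.adjoint T x ∈ M := fun x hx => by
    rw [hM, mem_orthogonal_span_iff] at hx ⊢
    intro e he
    obtain ⟨c, hce⟩ := hew e he
    rw [ContinuousLinearMap.adjoint_inner_right, hce, inner_smul_left, hx e he, mul_zero]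
  have hbot : M = ⊥ := by
    by_contra hne
    have : Nontrivial M := Submodule.nontrivial_iff_ne_bot.2 hne
    let S : M →L[ℂ] M := T.restrict hTM
    let S' : M →L[ℂ] M := (ContinuousLinearMap.adjoint T).restrict hTM'
    have hadj : S' = ContinuousLinearMap.adjoint S := by
      rw [ContinuousLinearMap.eq_adjoint_iff]
      exact fun x y => ContinuousLinearMap.adjoint_inner_left T (y : H) (x : H)
    have hS : IsStarNormal S := by
      rw [ContinuousLinearMap.isStarNormal_iff_norm_eq_adjoint, ← hadj]
      exact fun v => (ContinuousLinearMap.isStarNormal_iff_norm_eq_adjoint.1 hT) v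
    have hSc : IsCompactOperator S := hc.restrict' hTM
    obtain ⟨x, c, hx0, hx⟩ := hS.exists_eigenvector hSc
    have hx0' : (x : H) ≠ 0 := fun h => hx0 (Subtype.ext h)
    have hTx : T (x : H) = c • (x : H) := congrArg Subtype.val hx
    set y : H := ((‖(x : H)‖⁻¹ : ℝ) : ℂ) • (x : H) with hy
    have hyM : y ∈ M := M.smul_mem _ x.2
    have hy1 : ‖y‖ = 1 := by
      rw [hy, norm_smul, Complex.norm_real, norm_inv, norm_norm,
        inv_mul_cancel₀ (norm_ne_zero_iff.2 hx0')]
    have hyw := mem_orthogonal_span_iff.1 hyM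
    have hmem : y ∈ w := hw.le_of_ge (y := insert y w) ⟨orthonormal_insert how hy1 hyw, by
      rintro e (rfl | he)
      · exact ⟨c, by rw [hy, map_smul, hTx, smul_comm]⟩
      · exact hew e he⟩ (Set.subset_insert _ _) (Set.mem_insert _ _)
    have h0 := inner_self_eq_zero.1 (hyw y hmem)
    rw [h0, norm_zero] at hy1
    exact zero_ne_one hy1
  refine ⟨w, HilbertBasis.mkOfOrthogonalEqBot how (by rwa [Subtype.range_coe]),
    fun i => (hew i i.2).choose, fun i => ?_⟩
  rw [HilbertBasis.coe_mkOfOrthogonalEqBot]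
  exact (hew i i.2).choose_spec

/-- The Hilbert–Schmidt norm dominates the operator norm: compare a unit vector with the basis for
`S`, then the basis with itself for `star S`. -/
theorem HilbertBasis.norm_le_of_tsum_le [CompleteSpace H] {ι : Type*} (b : HilbertBasis ι ℂ H)
    {S : H →L[ℂ] H} {ε : ℝ} (hε : 0 ≤ ε)
    (h : ∑' i, ‖S (b i)‖ₑ ^ 2 ≤ ENNReal.ofReal (ε ^ 2)) : ‖S‖ ≤ ε := by
  refine ContinuousLinearMap.opNorm_le_of_unit_norm hε fun x hx => ?_
  have h1 := (isBessel_unit hx.le).tsum_enorm_apply_sq_le b S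
  have h2 := b.orthonormal.isBessel.tsum_enorm_apply_sq_le b (star S)
  rw [star_star] at h2
  rw [tsum_fintype, Finset.univ_unique, Finset.sum_singleton] at h1
  have h3 := h1.trans (h2.trans h)
  rw [enorm_sq_eq_ofReal, ENNReal.ofReal_le_ofReal_iff (sq_nonneg _)] at h3
  exact (sq_le_sq₀ (norm_nonneg _) hε).1 h3

theorem isCompactOperator_spanProj {ι : Type*} [Fintype ι] (v : ι → H) :
    IsCompactOperator (spanProj v) := by
  refine (compactOperator (RingHom.id ℂ) H H).sum_mem fun i _ => ?_
  change IsCompactOperator (InnerProductSpace.rankOne ℂ (v i) (v i))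
  rw [InnerProductSpace.rankOne_def']
  have h : IsCompactOperator (innerSL ℂ (v i)) := isCompactOperator_of_locallyCompactSpace_dom _
  exact h.clm_comp (ContinuousLinearMap.toSpanSingleton ℂ (v i))

/-- Hilbert--Schmidt operators are compact. -/
theorem IsSchatten.isCompactOperator_of_two [CompleteSpace H] {T : H →L[ℂ] H}
    (hT : IsSchatten 2 T) : IsCompactOperator T := by
  classical
  obtain ⟨w, b, -⟩ := exists_hilbertBasis ℂ H
  have hsum : ∑' i, ‖T (b i)‖ₑ ^ 2 ≠ ⊤ := by
    rw [tsum_enorm_apply_sq_eq_traceAbsPow_two]; exact hT.ne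
  -- The difference `T - T * spanProj` vanishes on `s` and equals `T` on the other basis vectors, so
  -- its squared Hilbert–Schmidt norm is a tail of a convergent sum.
  refine isCompactOperator_of_tendsto (l := Filter.atTop)
    (F := fun s : Finset w => T * spanProj fun i : s => b i) ?_
    (Filter.Eventually.of_forall fun s => (isCompactOperator_spanProj _).clm_comp T)
  rw [Metric.tendsto_nhds]
  intro ε hε
  have h1 := (ENNReal.tendsto_tsum_compl_atTop_zero hsum).eventually
    (gt_mem_nhds (ENNReal.ofReal_pos.2 (pow_pos (half_pos hε) 2)))
  filter_upwards [h1] with s hs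
  have ho : Orthonormal ℂ fun i : s => b i := b.orthonormal.comp _ Subtype.val_injective
  rw [dist_comm, dist_eq_norm]
  refine (b.norm_le_of_tsum_le (half_pos hε).le (le_trans (le_of_eq ?_) hs.le)).trans_lt
    (half_lt_self hε)
  have h0 : ∀ i ∈ s, (T - T * spanProj fun i : s => b i) (b i) = 0 := fun i hi => by
    rw [sub_apply, mul_apply_eq_comp, spanProj_apply_self ho ⟨i, hi⟩, sub_self]
  have h2 : ∀ i, i ∉ s → (T - T * spanProj fun i : s => b i) (b i) = T (b i) := fun i hi => by
    have : (spanProj fun i : s => b i) (b i) = 0 := by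
      rw [spanProj_apply]
      refine Finset.sum_eq_zero fun j _ => ?_
      rw [b.orthonormal.2, zero_smul]
      rintro rfl
      exact hi j.2
    rw [sub_apply, mul_apply_eq_comp, this, map_zero, sub_zero]
  have h3 : Function.support (fun i => ‖(T - T * spanProj fun i : s => b i) (b i)‖ₑ ^ 2) ⊆
      {i | i ∉ s} := by
    intro i hi his
    exact hi (by beta_reduce; rw [h0 i his, enorm_zero, zero_pow two_ne_zero])
  rw [← tsum_subtype_eq_of_support_subset h3]
  exact tsum_congr fun i => by rw [h2 i.1 i.2]

theorem Set.Countable.exists_injective_isLowerSet_range {α : Type*} {s : Set α}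
    (hs : s.Countable) : ∃ g : s → ℕ, Function.Injective g ∧ IsLowerSet (Set.range g) := by
  have := hs.to_subtype
  rcases finite_or_infinite s with hf | hi
  · obtain ⟨n, ⟨e⟩⟩ := Finite.exists_equiv_fin s
    refine ⟨fun i => e i, Fin.val_injective.comp e.injective, ?_⟩
    rintro a c hca ⟨i, rfl⟩
    exact ⟨e.symm ⟨c, lt_of_le_of_lt hca (e i).2⟩, by simp⟩
  · obtain ⟨d⟩ := nonempty_denumerable s
    refine ⟨Denumerable.eqv s, (Denumerable.eqv s).injective, ?_⟩
    rw [(Denumerable.eqv s).surjective.range_eq]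
    exact isLowerSet_univ

theorem HilbertBasis.summable_norm_eigenvalues [CompleteSpace H] {ι : Type*}
    (b : HilbertBasis ι ℂ H) {T : H →L[ℂ] H} (hT : IsSchatten 1 T) {c : ι → ℂ}
    (hc : ∀ i, T (b i) = c i • b i) : Summable fun i => ‖c i‖ := by
  have h := (b.orthonormal.isBessel.tsum_enorm_inner_le b.orthonormal.isBessel T).trans_lt hT
  have h1 : ∀ i, inner ℂ (b i) (T (b i)) = c i := fun i => by
    rw [hc, inner_smul_right, inner_self_eq_norm_sq_to_K, b.orthonormal.1]; simp
  simp_rw [h1, ← ofReal_norm] at h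
  have h2 := ENNReal.summable_toReal h.ne
  simpa using h2

/-- The series converges absolutely, the eigenvalues being summable; its limit is identified
pointwise by expanding `x` in the basis. -/
theorem HilbertBasis.hasSum_rankOne [CompleteSpace H] {ι : Type*}
    (b : HilbertBasis ι ℂ H) {T : H →L[ℂ] H} (hT : IsSchatten 1 T) {c : ι → ℂ}
    (hc : ∀ i, T (b i) = c i • b i) :
    HasSum (fun i => c i • InnerProductSpace.rankOne ℂ (b i) (b i)) T := by
  have hs : Summable fun i => c i • InnerProductSpace.rankOne ℂ (b i) (b i) := by
    refine Summable.of_norm ?_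
    simpa [norm_smul, b.orthonormal.1] using b.summable_norm_eigenvalues hT hc
  convert hs.hasSum
  ext x
  have h1 := (b.hasSum_repr x).mapL T
  have h2 := hs.hasSum.mapL (ContinuousLinearMap.apply ℂ H x)
  refine h1.unique ?_
  refine h2.congr_fun ?_
  intro i
  simp [b.repr_apply_apply, hc, smul_smul, mul_comm]

theorem IsStarNormal.exists_isSpectralDecomposition [CompleteSpace H] {T : H →L[ℂ] H}
    (hn : IsStarNormal T) (hT : IsSchatten 1 T) :
    ∃ (μ : ℕ → ℂ) (u : ℕ → H), IsSpectralDecomposition T μ u := by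
  obtain ⟨w, b, c, hc⟩ := hn.exists_hilbertBasis_eigenvectors
    (hT.of_one one_lt_two).isCompactOperator_of_two
  have hsum := b.hasSum_rankOne hT hc
  have hcount : (Function.support c).Countable := by
    have := (b.summable_norm_eigenvalues hT hc).countable_support
    refine this.mono fun i hi => ?_
    exact norm_ne_zero_iff.2 hi
  obtain ⟨g, hg, hlow⟩ := hcount.exists_injective_isLowerSet_range
  -- Only nonzero eigenvalues are numbered; both sequences are zero beyond the range of `g`.
  set μ : ℕ → ℂ := Function.extend g (fun i => c i) 0 with hμ
  set u : ℕ → H := Function.extend g (fun i => b i) 0 with hu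
  have hμg : ∀ i, μ (g i) = c i := fun i => hg.extend_apply _ _ i
  have hug : ∀ i, u (g i) = b i := fun i => hg.extend_apply _ _ i
  have hμ0 : ∀ n, μ n ≠ 0 ↔ n ∈ Set.range g := fun n => by
    refine ⟨fun h => ?_, ?_⟩
    · by_contra hn
      exact h (Function.extend_apply' _ _ _ hn)
    · rintro ⟨i, rfl⟩
      rw [hμg]
      exact i.2
  refine ⟨μ, u, fun m n hmn h => (hμ0 m).2 (hlow hmn ((hμ0 n).1 h)), ?_, ?_⟩
  · choose k hk using fun n : {n : ℕ // μ n ≠ 0} => (hμ0 n).1 n.2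
    have hkinj : Function.Injective fun n => (k n : w) := fun m n h => by
      have h' : k m = k n := Subtype.ext h
      exact Subtype.ext (by rw [← hk m, ← hk n, h'])
    convert b.orthonormal.comp _ hkinj using 1
    funext n
    rw [← hk n, hug]; rfl
  · rw [← hg.hasSum_iff]
    · have h1 := (hasSum_subtype_iff_of_support_subset (s := Function.support c) ?_).2 hsum
      · convert h1 using 1
        funext i
        simp only [Function.comp_apply, hμg, hug]
      · intro i hi hci
        exact hi (by beta_reduce; rw [hci, zero_smul])
    · intro n hn
      rw [← hμ0, not_not] at hn
      rw [hn, zero_smul]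

end

/-! ### Eigenvalue tails and the final estimate. -/

section

variable {H : Type*} [NormedAddCommGroup H] [InnerProductSpace ℂ H]

theorem IsBessel.tsum_mul_le {ι : Type*} {e f : ι → H} (he : IsBessel e) (hf : IsBessel f) (x : H) :
    ∑' i, ‖inner ℂ (f i) x‖ₑ * ‖inner ℂ x (e i)‖ₑ ≤ ‖x‖ₑ ^ 2 := by
  have h : 2 * ∑' i, ‖inner ℂ (f i) x‖ₑ * ‖inner ℂ x (e i)‖ₑ ≤ 2 * ‖x‖ₑ ^ 2 := by
    rw [← ENNReal.tsum_mul_left, two_mul (‖x‖ₑ ^ 2)]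
    refine (ENNReal.tsum_le_tsum fun i => ENNReal.two_mul_mul_le_add_sq _ _).trans ?_
    rw [ENNReal.tsum_add]
    refine add_le_add (hf x) (le_trans (le_of_eq (tsum_congr fun i => ?_)) (he x))
    rw [← ofReal_norm, ← ofReal_norm, norm_inner_symm]
  exact (ENNReal.mul_le_mul_iff_right two_ne_zero ENNReal.ofNat_ne_top).1 h

/-- A countable triangle inequality, with no orthogonality of `v`: expand each coefficient,
interchange the sums, and apply `IsBessel.tsum_mul_le` to each `v n`. -/
theorem traceAbsPow_one_le_tsum [CompleteSpace H] {κ : Type*} {μ : κ → ℂ} {v : κ → H}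
    {T : H →L[ℂ] H} (hT : HasSum (fun n => μ n • InnerProductSpace.rankOne ℂ (v n) (v n)) T) :
    traceAbsPow 1 T ≤ ∑' n, ‖μ n‖ₑ * ‖v n‖ₑ ^ 2 := by
  refine traceAbsPow_one_le fun w e f he hf => ?_
  have h1 : ∀ i, ‖inner ℂ (f i) (T (e i))‖ₑ ≤
      ∑' n, ‖μ n‖ₑ * (‖inner ℂ (f i) (v n)‖ₑ * ‖inner ℂ (v n) (e i)‖ₑ) := fun i => by
    have h2 := (hT.mapL (ContinuousLinearMap.apply ℂ H (e i))).mapL (innerSL ℂ (f i))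
    have h3 : inner ℂ (f i) (T (e i)) =
        ∑' n, μ n * (inner ℂ (f i) (v n) * inner ℂ (v n) (e i)) := by
      refine (h2.tsum_eq.symm.trans (tsum_congr fun n => ?_) :)
      simp [mul_comm]
    rw [h3]
    refine enorm_tsum_le_tsum_enorm.trans (le_of_eq (tsum_congr fun n => ?_))
    rw [enorm_mul, enorm_mul]
  refine (ENNReal.tsum_le_tsum h1).trans ?_
  rw [ENNReal.tsum_comm]
  refine ENNReal.tsum_le_tsum fun n => ?_
  rw [ENNReal.tsum_mul_left]
  gcongr
  exact he.tsum_mul_le hf (v n)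

namespace IsSpectralDecomposition

variable {A : H →L[ℂ] H} {μ : ℕ → ℂ} {u : ℕ → H}

theorem apply_eq (h : IsSpectralDecomposition A μ u) {n : ℕ} (hn : μ n ≠ 0) :
    A (u n) = μ n • u n := by
  have h1 := h.hasSum.mapL (ContinuousLinearMap.apply ℂ H (u n))
  refine h1.unique ?_
  convert hasSum_single n ?_ using 1
  · have : ‖u n‖ = 1 := h.orthonormal.1 ⟨n, hn⟩
    simp [inner_self_eq_norm_sq_to_K, this]
  · intro m hm
    by_cases hm0 : μ m = 0
    · simp [hm0]
    · have : inner ℂ (u m) (u n) = 0 := h.orthonormal.2 (i := ⟨m, hm0⟩) (j := ⟨n, hn⟩)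
        fun h' => hm (congrArg Subtype.val h')
      simp [this]

theorem summable_norm [CompleteSpace H] (h : IsSpectralDecomposition A μ u)
    (hA : IsSchatten 1 A) : Summable fun n => ‖μ n‖ := by
  have h1 := (h.orthonormal.isBessel.tsum_enorm_inner_le h.orthonormal.isBessel A).trans_lt hA
  have h2 : ∀ n : {n : ℕ // μ n ≠ 0}, ‖inner ℂ (u n) (A (u n))‖ₑ = ‖μ n‖ₑ := fun n => by
    have : ‖u n‖ = 1 := h.orthonormal.1 n
    rw [h.apply_eq n.2, inner_smul_right, inner_self_eq_norm_sq_to_K, this]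
    simp
  simp_rw [h2] at h1
  have h3 : ∑' n, ‖μ n‖ₑ < ⊤ := by
    refine lt_of_eq_of_lt (Eq.symm ?_) h1
    refine tsum_subtype_eq_of_support_subset (f := fun n => ‖μ n‖ₑ) (s := {n | μ n ≠ 0}) ?_
    intro n hn
    exact enorm_ne_zero.1 hn
  simpa using ENNReal.summable_toReal h3.ne

/-- The subtype is needed because `u n` is arbitrary where `μ n = 0`, and `N` may exceed the rank.
-/
theorem orthonormal_fin (h : IsSpectralDecomposition A μ u) (N : ℕ) :
    Orthonormal ℂ fun k : {k : Fin N // μ k ≠ 0} => u k.1 :=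
  h.orthonormal.comp (fun k : {k : Fin N // μ k ≠ 0} => (⟨k.1, k.2⟩ : {n : ℕ // μ n ≠ 0}))
    fun _ _ hab => Subtype.ext (Fin.ext (congrArg Subtype.val hab))

/-- Conjugation by `Q` replaces each `uₙ` by `Q uₙ`, which is zero for `n < N` with `μₙ ≠ 0` and has
norm at most `1` for the later eigenvectors. -/
theorem traceAbsPow_tail_le [CompleteSpace H] (h : IsSpectralDecomposition A μ u)
    (hA : IsSchatten 1 A) (N : ℕ) {Q : H →L[ℂ] H}
    (hQ : Q = 1 - spanProj fun k : {k : Fin N // μ k ≠ 0} => u k.1) :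
    traceAbsPow 1 (Q * A * Q) ≤ ENNReal.ofReal (∑' n, ‖μ (N + n)‖) := by
  have ho := h.orthonormal_fin N
  have hQs : star Q = Q := by rw [hQ, star_sub, star_one, star_spanProj]
  have hQ1 : ‖Q‖ ≤ 1 := hQ ▸ norm_one_sub_spanProj_le ho
  have hQ0 : ∀ n, n < N → μ n ≠ 0 → Q (u n) = 0 := fun n hn hn0 => by
    rw [hQ, sub_apply, one_apply_eq_self,
      spanProj_apply_self ho (⟨⟨n, hn⟩, hn0⟩ : {k : Fin N // μ k ≠ 0}), sub_self]
  have hsum : HasSum (fun n => μ n • InnerProductSpace.rankOne ℂ (Q (u n)) (Q (u n)))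
      (Q * A * Q) := by
    refine ((h.hasSum.mul_left Q).mul_right Q).congr_fun fun n => ?_
    ext x
    simp only [mul_apply_eq_comp, smul_apply, InnerProductSpace.rankOne_apply, map_smul]
    rw [← ContinuousLinearMap.adjoint_inner_right, ← ContinuousLinearMap.star_eq_adjoint, hQs]
  refine (traceAbsPow_one_le_tsum hsum).trans ?_
  have hsN : Summable fun n => ‖μ (N + n)‖ := by
    simpa only [add_comm N] using (summable_nat_add_iff N).2 (h.summable_norm hA)
  rw [ENNReal.ofReal_tsum_of_nonneg (fun _ => norm_nonneg _) hsN]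
  have hz : ∀ n ∉ Set.range (fun n => N + n), ‖μ n‖ₑ * ‖Q (u n)‖ₑ ^ 2 = 0 := fun n hn => by
    by_cases h0 : μ n = 0
    · simp [h0]
    · have hnN : n < N := by
        by_contra hc
        exact hn ⟨n - N, by simp; omega⟩
      simp [hQ0 n hnN h0]
  rw [← (add_right_injective N).tsum_eq (Function.support_subset_iff'.2 hz)]
  refine ENNReal.tsum_le_tsum fun n => ?_
  rw [ofReal_norm]
  by_cases h0 : μ (N + n) = 0
  · simp [h0]
  · refine mul_le_of_le_one_right' ?_
    have hu : ‖u (N + n)‖ = 1 := h.orthonormal.1 ⟨N + n, h0⟩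
    have : ‖Q (u (N + n))‖ ≤ 1 := by
      refine (Q.le_opNorm _).trans ?_
      rwa [hu, mul_one]
    refine pow_le_one₀ (by simp) ?_
    rw [← ofReal_norm]
    exact ENNReal.ofReal_le_one.2 this

end IsSpectralDecomposition

theorem tailSet_nonempty {μ : ℕ → ℂ} {ε : ℝ} (hε : 0 < ε) :
    (tailSet μ ε).Nonempty := by
  -- This limit holds for every sequence: without summability all tails are `0` by convention.
  have h := (tendsto_sum_nat_add fun n => ‖μ n‖).eventually (gt_mem_nhds hε)
  obtain ⟨N, hN⟩ := h.exists
  exact ⟨N, by simpa only [tailSet, Set.mem_ofPred_eq, add_comm N] using hN⟩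

variable [CompleteSpace H]

theorem schattenNorm_one (T : H →L[ℂ] H) : schattenNorm 1 T = (traceAbsPow 1 T).toReal := by
  rw [schattenNorm, one_div_one, Real.rpow_one]

theorem IsSchatten.sub_one {S T : H →L[ℂ] H} (hS : IsSchatten 1 S) (hT : IsSchatten 1 T) :
    IsSchatten 1 (S - T) := by
  rw [IsSchatten, sub_eq_add_neg]
  refine (traceAbsPow_one_add_le _ _).trans_lt ?_
  rw [traceAbsPow_neg]
  exact ENNReal.add_lt_top.2 ⟨hS, hT⟩

/-- `‖A₀ - A‖₁` is controlled by `‖P (A₀ - A)‖₁`, `‖(A₀ - A) P‖₁` and `‖Q A₀ Q‖₁`, for a projection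
`P` with complement `Q`. -/
theorem traceNorm_sub_le_of_proj {A₀ A P Q : H →L[ℂ] H} (hPs : star P = P) (hQs : star Q = Q)
    (hPP : P * P = P) (hPQ : P + Q = 1) (hsq : ∀ x, ‖P x‖ ^ 2 + ‖Q x‖ ^ 2 ≤ ‖x‖ ^ 2)
    (hP1 : ‖P‖ ≤ 1) (hQ1 : ‖Q‖ ≤ 1) (hcomm : P * A₀ = A₀ * P)
    (h₀ : IsSchatten 1 A₀) (h : IsSchatten 1 A)
    (hn : (traceAbsPow 1 A).toReal = (traceAbsPow 1 A₀).toReal) {a ε : ℝ} (ha : 0 ≤ a)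
    (hε : 0 ≤ ε)
    (h1 : traceAbsPow 1 ((A₀ - A) * P) ≤ ENNReal.ofReal a)
    (h2 : traceAbsPow 1 (P * (A₀ - A)) ≤ ENNReal.ofReal a)
    (h3 : traceAbsPow 1 (Q * A₀ * Q) ≤ ENNReal.ofReal ε) :
    (traceAbsPow 1 (A₀ - A)).toReal ≤ 3 * a + 2 * ε := by
  have hPle : ∀ T : H →L[ℂ] H, traceAbsPow 1 (P * T * P) ≤ traceAbsPow 1 T := fun T =>
    traceAbsPow_one_mul_mul_le hP1 hP1 T
  have hQle : ∀ T : H →L[ℂ] H, traceAbsPow 1 (Q * T * Q) ≤ traceAbsPow 1 T := fun T =>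
    traceAbsPow_one_mul_mul_le hQ1 hQ1 T
  have hDP : ∀ {B : H →L[ℂ] H}, ‖B‖ ≤ 1 →
      traceAbsPow 1 (B * (A₀ - A) * P) ≤ ENNReal.ofReal a := fun {B} hB => by
    have h5 := traceAbsPow_one_mul_mul_le (B := B) (C := 1) hB
      ContinuousLinearMap.norm_id_le ((A₀ - A) * P)
    rw [mul_one, ← mul_assoc] at h5
    exact h5.trans h1
  have e1 : traceAbsPow 1 (A₀ - A) ≤ traceAbsPow 1 (P * (A₀ - A)) +
      traceAbsPow 1 (Q * (A₀ - A) * P) +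
        (traceAbsPow 1 (Q * A₀ * Q) + traceAbsPow 1 (Q * A * Q)) := by
    have d : A₀ - A = P * (A₀ - A) + Q * (A₀ - A) * P + (Q * A₀ * Q + -(Q * A * Q)) := by
      have hQe : Q = 1 - P := eq_sub_of_add_eq' hPQ
      rw [hQe]; noncomm_ring
    nth_rewrite 1 [d]
    refine (traceAbsPow_one_add_le _ _).trans (add_le_add (traceAbsPow_one_add_le _ _) ?_)
    refine (traceAbsPow_one_add_le _ _).trans_eq ?_
    rw [traceAbsPow_neg]
  have e2 : traceAbsPow 1 A₀ ≤ traceAbsPow 1 (P * A₀ * P) + traceAbsPow 1 (Q * A₀ * Q) := by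
    -- The off-diagonal blocks vanish because `P` commutes with `A₀`.
    have d : A₀ = P * A₀ * P + Q * A₀ * Q := by
      have hQe : Q = 1 - P := eq_sub_of_add_eq' hPQ
      have hc : P * A₀ * P = A₀ * P := by rw [hcomm, mul_assoc, hPP]
      rw [hQe, sub_mul, one_mul, mul_sub, mul_one, sub_mul, hc, hcomm]
      abel
    nth_rewrite 1 [d]
    exact traceAbsPow_one_add_le _ _
  have e3 : traceAbsPow 1 (P * A₀ * P) ≤
      traceAbsPow 1 (P * (A₀ - A) * P) + traceAbsPow 1 (P * A * P) := by
    refine le_trans (le_of_eq ?_) (traceAbsPow_one_add_le _ _)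
    congr 1
    noncomm_ring
  -- Pinching is what makes a large `PAP` force a small `QAQ`, given the norm of `A`.
  have e4 := traceAbsPow_one_pinching hPs hQs hsq A
  have f1 := (hPle A₀).trans_lt h₀
  have f2 := (hQle A₀).trans_lt h₀
  have f3 := (hPle A).trans_lt h
  have f4 := (hQle A).trans_lt h
  have f5 := h2.trans_lt ENNReal.ofReal_lt_top
  have f6 := (hDP hQ1).trans_lt ENNReal.ofReal_lt_top
  have f7 := (hDP hP1).trans_lt ENNReal.ofReal_lt_top
  have g1 := ENNReal.toReal_mono (by simp [f2.ne, f4.ne, f5.ne, f6.ne]) e1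
  rw [ENNReal.toReal_add (ENNReal.add_lt_top.2 ⟨f5, f6⟩).ne (ENNReal.add_lt_top.2 ⟨f2, f4⟩).ne,
    ENNReal.toReal_add f5.ne f6.ne, ENNReal.toReal_add f2.ne f4.ne] at g1
  have g2 := ENNReal.toReal_mono (ENNReal.add_lt_top.2 ⟨f1, f2⟩).ne e2
  rw [ENNReal.toReal_add f1.ne f2.ne] at g2
  have g3 := ENNReal.toReal_mono (ENNReal.add_lt_top.2 ⟨f7, f3⟩).ne e3
  rw [ENNReal.toReal_add f7.ne f3.ne] at g3
  have g4 := ENNReal.toReal_mono h.ne e4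
  rw [ENNReal.toReal_add f3.ne f4.ne] at g4
  have k1 := ENNReal.toReal_le_of_le_ofReal ha h2
  have k2 := ENNReal.toReal_le_of_le_ofReal ha (hDP hQ1)
  have k3 := ENNReal.toReal_le_of_le_ofReal ha (hDP hP1)
  have k4 := ENNReal.toReal_le_of_le_ofReal hε h3
  linarith

/-- Every `N` in the tail set works; minimality plays no role in the estimate. -/
theorem IsSpectralDecomposition.schattenNorm_sub_le {A₀ A : H →L[ℂ] H} {μ : ℕ → ℂ} {u : ℕ → H}
    (h : IsSpectralDecomposition A₀ μ u) {p q : ℝ} (hpq : p.HolderConjugate q)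
    (h₀ : IsSchatten 1 A₀) (hA : IsSchatten 1 A) (hn : schattenNorm 1 A = schattenNorm 1 A₀)
    (hDp : IsSchatten p (A₀ - A)) {N : ℕ} (hN : N ∈ tailSet μ (schattenNorm p (A₀ - A))) :
    schattenNorm 1 (A₀ - A) ≤
      (3 * (N : ℝ) ^ (1 / q) + 2) * schattenNorm p (A₀ - A) := by
  rw [schattenNorm_one, schattenNorm_one] at hn
  rw [schattenNorm_one]
  have ho := h.orthonormal_fin N
  set v : {k : Fin N // μ k ≠ 0} → H := fun k => u k.1 with hv
  set ε := schattenNorm p (A₀ - A) with hε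
  have hε0 : 0 ≤ ε := Real.rpow_nonneg ENNReal.toReal_nonneg _
  have hle : (Fintype.card {k : Fin N // μ k ≠ 0} : ℝ) ^ (1 / q) * ε ≤ (N : ℝ) ^ (1 / q) * ε := by
    refine mul_le_mul_of_nonneg_right (Real.rpow_le_rpow (Nat.cast_nonneg _) ?_
      (one_div_nonneg.2 hpq.symm.nonneg)) hε0
    exact_mod_cast (Fintype.card_subtype_le _).trans_eq (Fintype.card_fin N)
  have hcomm : spanProj v * A₀ = A₀ * spanProj v := by
    have hrank : ∀ n k, Commute (InnerProductSpace.rankOne ℂ (v k) (v k))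
        (μ n • InnerProductSpace.rankOne ℂ (u n) (u n)) := fun n k => by
      by_cases hn0 : μ n = 0
      · rw [hn0, zero_smul]; exact Commute.zero_right _
      refine Commute.smul_right ?_ _
      by_cases hnk : n = k.1
      · subst hnk; exact Commute.refl _
      · have h1 : inner ℂ (v k) (u n) = 0 := h.orthonormal.2 (i := ⟨k.1, k.2⟩) (j := ⟨n, hn0⟩)
          fun h' => hnk (congrArg Subtype.val h').symm
        have h2 : inner ℂ (u n) (v k) = 0 := inner_eq_zero_symm.1 h1
        rw [Commute, SemiconjBy, ContinuousLinearMap.mul_def, ContinuousLinearMap.mul_def,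
          InnerProductSpace.rankOne_comp_rankOne, InnerProductSpace.rankOne_comp_rankOne, h1, h2,
          zero_smul, zero_smul]
    refine (h.hasSum.mul_left (spanProj v)).unique ((h.hasSum.mul_right (spanProj v)).congr_fun
      fun n => ?_)
    exact (Commute.sum_left _ _ _ fun k _ => hrank n k).eq
  have key := traceNorm_sub_le_of_proj (P := spanProj v) (Q := 1 - spanProj v) (star_spanProj v)
    (by rw [star_sub, star_one, star_spanProj]) (spanProj_mul_self ho) (add_sub_cancel _ _)
    (fun x => (spanProj_norm_sq_add ho x).le) (norm_spanProj_le ho) (norm_one_sub_spanProj_le ho)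
    hcomm h₀ hA hn (a := (N : ℝ) ^ (1 / q) * ε) (by positivity) hε0
    ((traceAbsPow_mul_spanProj_le ho hpq hDp).trans (ENNReal.ofReal_le_ofReal hle))
    ((traceAbsPow_spanProj_mul_le ho hpq hDp).trans (ENNReal.ofReal_le_ofReal hle))
    ((h.traceAbsPow_tail_le h₀ N rfl).trans (ENNReal.ofReal_le_ofReal (le_of_lt hN)))
  linarith

end

theorem corollary2 {H : Type*} [NormedAddCommGroup H] [InnerProductSpace ℂ H] [CompleteSpace H]
    (p q : ℝ) (hp : 1 < p) (hq : q = p / (p - 1))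
    (A₀ : H →L[ℂ] H) (hA₀ : IsSchatten 1 A₀) (hnormal : IsStarNormal A₀)
    (hA₀_norm : schattenNorm 1 A₀ = 1) :
    (∃ (μ : ℕ → ℂ) (u : ℕ → H), IsSpectralDecomposition A₀ μ u) ∧
    ∀ (μ : ℕ → ℂ) (u : ℕ → H), IsSpectralDecomposition A₀ μ u →
      Summable (fun n => ‖μ n‖) ∧
      (∀ ε : ℝ, 0 < ε → (tailSet μ ε).Nonempty) ∧
      ∀ A : H →L[ℂ] H, IsSchatten 1 A → schattenNorm 1 A = 1 →
        IsSchatten 1 (A₀ - A) ∧ IsSchatten p (A₀ - A) ∧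
        schattenNorm 1 (A₀ - A) ≤
          (3 * (tailIndex μ (schattenNorm p (A₀ - A)) : ℝ) ^ (1 / q) + 2) *
            schattenNorm p (A₀ - A) := by
  have hpq : p.HolderConjugate q := hq ▸ Real.HolderConjugate.conjExponent hp
  refine ⟨hnormal.exists_isSpectralDecomposition hA₀, fun μ u h => ⟨h.summable_norm hA₀,
    fun ε hε => tailSet_nonempty hε, fun A hA hA_norm => ?_⟩⟩
  have hD : IsSchatten 1 (A₀ - A) := hA₀.sub_one hA
  have hDp : IsSchatten p (A₀ - A) := hD.of_one hp
  refine ⟨hD, hDp, ?_⟩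
  have hε : 0 ≤ schattenNorm p (A₀ - A) := Real.rpow_nonneg ENNReal.toReal_nonneg _
  -- At `ε = 0` the tail set is empty and `tailIndex` is the junk value `sInf ∅ = 0`; the factor `ε`
  -- annihilates the right-hand side anyway.
  rcases hε.eq_or_lt with h0 | hpos
  · rw [← h0, mul_zero, schattenNorm_one, traceAbsPow_one_eq_zero hpq hDp h0.symm]
    exact le_rfl
  · exact h.schattenNorm_sub_le hpq hA₀ hA (hA_norm.trans hA₀_norm.symm) hDp
      (Nat.sInf_mem (tailSet_nonempty hpos))
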